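/- Let $\Bbbk$ be an algebraically closed field of characteristic $0$, let $n,d\ge 0$, and let $\mathcal S=\Bbbk[X_0,\dots,X_n]$ and $\mathcal R=\Bbbk[Y_0,\dots,Y_n]$ with their standard gradings, where $\mathcal R$ acts on $\mathcal S$ by differentiation, $Y_i\circ F=\partial F/\partial X_i$, and $\mathcal R$ is the homogeneous coordinate ring of $\mathbb P^n$. For a $0$-dimensional closed subscheme $Z\subset\mathbb P^n$ (possibly empty) let $I(Z)\subseteq\mathcal R$ be its saturated homogeneous ideal and let $\mathrm{HF}_Z(i)=\dim_{\Bbbk}\mathcal R_i/I(Z)_i$ be its Hilbert function. The scheme $Z$ is *apolar* to a form $F\in\mathcal S_d$ if $I(Z)\subseteq\mathrm{Ann}(F)=\{G\in\mathcal R : G\circ F=0\}$, and *$d$-regular* if $\mathrm{reg}(Z)=\min\{i\in\mathbb N : \mathrm{HF}_Z(i)=\mathrm{HF}_Z(i+1)=\mathrm{len}(Z)\}\le d$. Let $F\in\mathcal S_d$, and let $Z\subset\mathbb P^n$ be a $0$-dimensional scheme all of whose irreducible components $Z_1,\dots,Z_r$ (the local schemes at its points) have length at most $2$. If $Z$ is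 apolar to $F$ and has minimal length among all $0$-dimensional subschemes of $\mathbb P^n$ apolar to $F$, then $Z$ is $d$-regular. -/

import Mathlib

open MvPolynomial

namespace Apolarity

noncomputable section

/-- The standard grading of the polynomial ring `k[Y_0, …, Y_n]`. -/
abbrev stdGrading (k : Type*) [Field k] (n : ℕ) : ℕ → Submodule k (MvPolynomial (Fin (n + 1)) k) :=
  homogeneousSubmodule (Fin (n + 1)) k

instance stdGradedAlgebra (k : Type*) [Field k] (n : ℕ) : GradedAlgebra (stdGrading k n) :=
  MvPolynomial.gradedAlgebra

/-- The derivative `∂_β F = Y^β ∘ F`. On a monomial it is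
`∂_β (X^α) = (α! / (α - β)!) X^(α - β)` if `β ≤ α`, and `0` otherwise
(a descending factorial `α_i (α_i - 1) ⋯ (α_i - β_i + 1)` vanishes as soon as `α_i < β_i`). -/
def monomialDeriv {k : Type*} [Field k] {n : ℕ} (β : Fin (n + 1) →₀ ℕ)
    (F : MvPolynomial (Fin (n + 1)) k) : MvPolynomial (Fin (n + 1)) k :=
  ∑ α ∈ F.support,
    monomial (α - β) (((∏ i, (α i).descFactorial (β i) : ℕ) : k) * coeff α F)

/-- The apolarity action `G ∘ F` of `R = k[Y_0, …, Y_n]` on `S = k[X_0, …, X_n]` by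
differentiation. -/
def diffAction {k : Type*} [Field k] {n : ℕ}
    (G F : MvPolynomial (Fin (n + 1)) k) : MvPolynomial (Fin (n + 1)) k :=
  ∑ β ∈ G.support, coeff β G • monomialDeriv β F

/-- `Ann(F) = {G ∈ R : G ∘ F = 0}`. -/
def Ann {k : Type*} [Field k] {n : ℕ} (F : MvPolynomial (Fin (n + 1)) k) :
    Set (MvPolynomial (Fin (n + 1)) k) :=
  {G | diffAction G F = 0}

/-- A `0`-dimensional closed subscheme `Z` of `ℙⁿ = Proj k[Y_0, …, Y_n]`, given by its ideal `I(Z)`: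
a homogeneous ideal, saturated with respect to `(Y_0, …, Y_n)`, whose zero locus in `Proj` consists
of finitely many points. (The empty scheme, with `I(Z) = R`, is included.) -/
structure ZeroDimScheme (k : Type*) [Field k] (n : ℕ) where
  /-- The homogeneous ideal `I(Z)`. -/
  ideal : HomogeneousIdeal (stdGrading k n)
  saturated : ∀ f : MvPolynomial (Fin (n + 1)) k,
    (∀ i, X i * f ∈ ideal.toIdeal) → f ∈ ideal.toIdeal
  finite_zeroLocus :
    (ProjectiveSpectrum.zeroLocus (stdGrading k n) (ideal.toIdeal : Set _)).Finite

namespace ZeroDimScheme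

variable {k : Type*} [Field k] {n : ℕ}

/-- The finite set of points of `Z`. Each of them carries exactly one irreducible (equivalently,
connected) component of `Z`. -/
def points (Z : ZeroDimScheme k n) : Finset (ProjectiveSpectrum (stdGrading k n)) :=
  Z.finite_zeroLocus.toFinset

/-- The local ring `𝒪_{ℙⁿ,p}`: fractions `a / b` of homogeneous polynomials of the same degree
with `b` not in the homogeneous prime of `p`. -/
abbrev LocalRingAt (p : ProjectiveSpectrum (stdGrading k n)) : Type _ :=
  HomogeneousLocalization.AtPrime (stdGrading k n) p.asHomogeneousIdeal.toIdeal

/-- The stalk at `p` of the ideal sheaf of `Z`: the fractions of degree zero that lie in the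
extension of `I(Z)` to the localization of `R` at the prime of `p`. -/
def stalkIdeal (Z : ZeroDimScheme k n) (p : ProjectiveSpectrum (stdGrading k n)) :
    Ideal (LocalRingAt p) :=
  ((Z.ideal.toIdeal).map
      (algebraMap (MvPolynomial (Fin (n + 1)) k)
        (Localization.AtPrime p.asHomogeneousIdeal.toIdeal))).comap
    (algebraMap (LocalRingAt p) (Localization.AtPrime p.asHomogeneousIdeal.toIdeal))

/-- The length of the component of `Z` at `p`: the length of the local ring
`𝒪_{Z,p} = 𝒪_{ℙⁿ,p} / I_{Z,p}`. -/
def localLength (Z : ZeroDimScheme k n) (p : ProjectiveSpectrum (stdGrading k n)) : ℕ∞ :=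
  Module.length (LocalRingAt p) (LocalRingAt p ⧸ Z.stalkIdeal p)

/-- The length of `Z`: the sum of the lengths of its components. -/
def len (Z : ZeroDimScheme k n) : ℕ∞ :=
  ∑ p ∈ Z.points, Z.localLength p

/-- The Hilbert function `HF_Z(i) = dim_k R_i / I(Z)_i`, with `I(Z)_i = I(Z) ∩ R_i`. -/
def HF (Z : ZeroDimScheme k n) (i : ℕ) : ℕ :=
  Module.finrank k
    (stdGrading k n i ⧸
      (Z.ideal.toIdeal.restrictScalars k).comap (stdGrading k n i).subtype)

/-- The regularity of `Z`: the least `i` with `HF_Z(i) = HF_Z(i+1) = len(Z)`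
(with value `⊤` if there were no such `i`). -/
def reg (Z : ZeroDimScheme k n) : ℕ∞ :=
  ⨅ i ∈ {i : ℕ | (Z.HF i : ℕ∞) = Z.len ∧ (Z.HF (i + 1) : ℕ∞) = Z.len}, (i : ℕ∞)

/-- `Z` is regular in degree `d`. -/
def IsRegularInDegree (Z : ZeroDimScheme k n) (d : ℕ) : Prop :=
  Z.reg ≤ d

/-- `Z` is apolar to `F`: `I(Z) ⊆ Ann(F)`. -/
def IsApolar (Z : ZeroDimScheme k n) (F : MvPolynomial (Fin (n + 1)) k) : Prop :=
  (Z.ideal.toIdeal : Set _) ⊆ Ann F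

/-- `Z` has minimal length among the `0`-dimensional schemes in `ℙⁿ` apolar to `F`. -/
def IsMinimalApolar (Z : ZeroDimScheme k n) (F : MvPolynomial (Fin (n + 1)) k) : Prop :=
  Z.IsApolar F ∧ ∀ Z' : ZeroDimScheme k n, Z'.IsApolar F → Z.len ≤ Z'.len

end ZeroDimScheme

end

end Apolarity

/-! A component of length at most two is a point together with a (possibly zero) tangent vector, so
`I(Z)_d` is the common kernel of the evaluations and directional derivatives at these points. By
apolarity the functional `G ↦ G ∘ F` on forms of degree `d` is a linear combination of them, and by
minimality no representation of it of smaller total length exists. Subtracting a multiple of a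
linear relation between these conditions would give one. The delicate case is a relation between
values alone that involves a point `p` where `Z` has length two: substituting `l ∂_w G` for `G`,
where `l(p) ≠ 0` and `w` is the tangent vector of `Z` at `p`, turns it into a relation between
derivatives in the direction `w`, which can be used to cancel the tangent vector at `p`. Hence the
conditions are independent in degree `d`, therefore also in degree `d + 1`, which says that
`HF_Z(d) = HF_Z(d + 1) = len(Z)`.
-/

namespace Apolarity

noncomputable section

section DualNumbers

open DualNumber

variable {σ R : Type*} [CommRing R]

/-- Evaluation of polynomials at the tangent vector `a + v ε` with values in the dual numbers. It
records the value of a polynomial at `a` together with its derivative in the direction `v`. -/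
def dualEval (a v : σ → R) : MvPolynomial σ R →ₐ[R] R[ε] :=
  aeval fun i => TrivSqZeroExt.inl (a i) + TrivSqZeroExt.inr (v i)

@[simp]
lemma fst_dualEval (a v : σ → R) (G : MvPolynomial σ R) : (dualEval a v G).fst = eval a G := by
  have h : (TrivSqZeroExt.fstHom R R R).comp (dualEval a v) = aeval a :=
    algHom_ext fun i => by simp [dualEval]
  exact DFunLike.congr_fun h G

lemma isUnit_dualEval_iff {a v : σ → R} {G : MvPolynomial σ R} :
    IsUnit (dualEval a v G) ↔ IsUnit (eval a G) := by
  rw [TrivSqZeroExt.isUnit_iff_isUnit_fst, fst_dualEval]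

variable [Fintype σ]

/-- The derivative `∑ i, v i * (∂G/∂X_i)(a)` of `G` at `a` in the direction `v`, as a bilinear
function of `v` and `G`. -/
def dirDeriv (a : σ → R) : (σ → R) →ₗ[R] MvPolynomial σ R →ₗ[R] R :=
  Fintype.linearCombination R fun i => (aeval a).toLinearMap ∘ₗ (pderiv i).toLinearMap

lemma dirDeriv_apply (a v : σ → R) (G : MvPolynomial σ R) :
    dirDeriv a v G = ∑ i, v i * eval a (pderiv i G) := by
  simp [dirDeriv, Fintype.linearCombination_apply, aeval_eq_eval]

lemma dirDeriv_mul (a v : σ → R) (G H : MvPolynomial σ R) :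
    dirDeriv a v (G * H) = eval a G * dirDeriv a v H + dirDeriv a v G * eval a H := by
  simp only [dirDeriv_apply, Derivation.leibniz, smul_eq_mul, map_add, map_mul, Finset.mul_sum,
    Finset.sum_mul, ← Finset.sum_add_distrib]
  exact Finset.sum_congr rfl fun i _ => by ring

@[simp]
lemma snd_dualEval (a v : σ → R) (G : MvPolynomial σ R) :
    (dualEval a v G).snd = dirDeriv a v G := by
  classical
  induction G using MvPolynomial.induction_on with
  | C c => simp [dualEval, dirDeriv_apply, TrivSqZeroExt.algebraMap_eq_inl]
  | add G H hG hH => simp [hG, hH]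
  | mul_X G i hG =>
    rw [map_mul, DualNumber.snd_mul, hG, fst_dualEval, dirDeriv_mul]
    simp [dualEval, dirDeriv_apply, pderiv_X, Pi.single_apply]

lemma dualEval_eq_zero_iff {a v : σ → R} {G : MvPolynomial σ R} :
    dualEval a v G = 0 ↔ eval a G = 0 ∧ dirDeriv a v G = 0 := by
  simp [TrivSqZeroExt.ext_iff]

end DualNumbers

section Forms

variable {σ R A : Type*} [CommRing R] [CommRing A] [Algebra R A]

lemma aeval_mul_of_isHomogeneous {G : MvPolynomial σ R} {e : ℕ} (hG : G.IsHomogeneous e) (l : A)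
    (x : σ → A) : aeval (fun i => l * x i) G = l ^ e * aeval x G := by
  rw [aeval_def, aeval_def, eval₂_eq, eval₂_eq, Finset.mul_sum]
  refine Finset.sum_congr rfl fun α hα => ?_
  rw [hG.degree_eq_sum_deg_support hα, mul_left_comm, ← Finset.prod_pow_eq_pow_sum,
    ← Finset.prod_mul_distrib]
  simp only [mul_pow]

lemma exists_isHomogeneous_one_eval_eq_one {k : Type*} [Field k] {a : σ → k} (ha : a ≠ 0) :
    ∃ l : MvPolynomial σ k, l.IsHomogeneous 1 ∧ eval a l = 1 := by
  obtain ⟨i, hi⟩ := Function.ne_iff.mp ha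
  exact ⟨C (a i)⁻¹ * X i, (isHomogeneous_X k i).C_mul _, by simpa using inv_mul_cancel₀ hi⟩

end Forms

section Graded

variable {ι τ A : Type*} [CommSemiring A] [SetLike τ A] [AddSubmonoidClass τ A] [DecidableEq ι]
  [AddCancelMonoid ι] {𝒜 : ι → τ} [GradedRing 𝒜]

lemma homogeneousIdeal_le_of_forall_homogeneous_mem {I J : HomogeneousIdeal 𝒜}
    (h : ∀ i, ∀ x ∈ 𝒜 i, x ∈ I → x ∈ J) : I ≤ J := fun _ hx =>
  (J.isHomogeneous.mem_iff 𝒜).mpr fun i => h i _ (SetLike.coe_mem _) (I.isHomogeneous i hx)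

lemma mem_homogeneousCore_iff_of_mem {I : Ideal A} {i : ι} {x : A} (hx : x ∈ 𝒜 i) :
    x ∈ I.homogeneousCore 𝒜 ↔ x ∈ I :=
  ⟨fun h => Ideal.toIdeal_homogeneousCore_le 𝒜 I h,
    Ideal.mem_homogeneousCore_of_homogeneous_of_mem ⟨i, hx⟩⟩

lemma mem_homogeneousCore_of_mul_mem {I : Ideal A} {j : ι} {s x : A} (hs : s ∈ 𝒜 j)
    (h : ∀ y, s * y ∈ I → y ∈ I) (hx : s * x ∈ I.homogeneousCore 𝒜) :
    x ∈ I.homogeneousCore 𝒜 := by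
  refine ((I.homogeneousCore 𝒜).isHomogeneous.mem_iff 𝒜).mpr fun i => ?_
  refine (mem_homogeneousCore_iff_of_mem (SetLike.coe_mem _)).mpr (h _ ?_)
  rw [← DirectSum.coe_decompose_mul_add_of_left_mem 𝒜 hs]
  exact Ideal.toIdeal_homogeneousCore_le 𝒜 I ((I.homogeneousCore 𝒜).isHomogeneous _ hx)

lemma isHomogeneous_colon_singleton {I : Ideal A} (hI : I.IsHomogeneous 𝒜) {j : ι} {f : A}
    (hf : f ∈ 𝒜 j) : (I.colon {f}).IsHomogeneous 𝒜 := by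
  intro i r hr
  rw [Submodule.mem_colon_singleton, smul_eq_mul] at hr ⊢
  rw [← DirectSum.coe_decompose_mul_add_of_right_mem 𝒜 hf]
  exact hI _ hr

end Graded

section TangentIdeal

variable {k : Type*} [Field k] {n : ℕ}

/-- The homogeneous ideal generated by the forms vanishing to first order at `a` in the direction
`v`: for `a ≠ 0` it cuts out the point with homogeneous coordinates `a` if `v = 0`, and in general
the subscheme of length at most two spanned by the tangent vector `v` at that point. -/
def tangentIdeal (a v : Fin (n + 1) → k) : HomogeneousIdeal (stdGrading k n) :=
  (RingHom.ker (dualEval a v)).homogeneousCore (stdGrading k n)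

lemma mem_tangentIdeal_iff {a v : Fin (n + 1) → k} {G : MvPolynomial (Fin (n + 1)) k} {e : ℕ}
    (hG : G.IsHomogeneous e) :
    G ∈ tangentIdeal a v ↔ eval a G = 0 ∧ dirDeriv a v G = 0 := by
  rw [tangentIdeal, mem_homogeneousCore_iff_of_mem hG, RingHom.mem_ker, dualEval_eq_zero_iff]

lemma mem_tangentIdeal_of_forall_X_mul_mem {a v : Fin (n + 1) → k} (ha : a ≠ 0)
    {f : MvPolynomial (Fin (n + 1)) k} (hf : ∀ i, X i * f ∈ tangentIdeal a v) :
    f ∈ tangentIdeal a v := by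
  obtain ⟨i, hi⟩ := Function.ne_iff.mp ha
  refine mem_homogeneousCore_of_mul_mem (isHomogeneous_X k i) (fun g hg => ?_) (hf i)
  have hunit : IsUnit (dualEval a v (X i)) := isUnit_dualEval_iff.mpr (by simpa using hi)
  rwa [RingHom.mem_ker, map_mul, hunit.mul_right_eq_zero] at hg

lemma mem_tangentIdeal_zero_iff {a : Fin (n + 1) → k} {G : MvPolynomial (Fin (n + 1)) k} {e : ℕ}
    (hG : G.IsHomogeneous e) : G ∈ tangentIdeal a 0 ↔ eval a G = 0 := by
  simp [mem_tangentIdeal_iff hG]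

lemma eval_eq_zero_of_mem_tangentIdeal {a v : Fin (n + 1) → k} {f : MvPolynomial (Fin (n + 1)) k}
    (hf : f ∈ tangentIdeal a v) : eval a f = 0 :=
  (dualEval_eq_zero_iff.mp (Ideal.toIdeal_homogeneousCore_le _ _ hf)).1

lemma isPrime_tangentIdeal_zero (a : Fin (n + 1) → k) : (tangentIdeal a 0).toIdeal.IsPrime := by
  have h : RingHom.ker (dualEval a 0) = RingHom.ker (eval a) := by
    ext G
    simp [dualEval_eq_zero_iff]
  rw [tangentIdeal, h]
  exact (RingHom.ker_isPrime (eval a)).homogeneousCore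

lemma tangentIdeal_zero_mul_self_le (a v : Fin (n + 1) → k) :
    tangentIdeal a 0 * tangentIdeal a 0 ≤ tangentIdeal a v := by
  refine (Ideal.homogeneousCore.gc _ _ _).mp ?_
  rw [HomogeneousIdeal.toIdeal_mul, Ideal.mul_le]
  intro f hf g hg
  rw [RingHom.mem_ker, dualEval_eq_zero_iff]
  simp [dirDeriv_mul, eval_eq_zero_of_mem_tangentIdeal hf, eval_eq_zero_of_mem_tangentIdeal hg]

end TangentIdeal

section RationalPoints

variable {k : Type*} [Field k] {n : ℕ}

/-- The point `p` is rational, with homogeneous coordinates `a`. -/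
def HasCoordinates (p : ProjectiveSpectrum (stdGrading k n)) (a : Fin (n + 1) → k) : Prop :=
  p.asHomogeneousIdeal = tangentIdeal a 0

lemma toIdeal_irrelevant_stdGrading :
    (HomogeneousIdeal.irrelevant (stdGrading k n)).toIdeal = idealOfVars (Fin (n + 1)) k := by
  refine le_antisymm ((HomogeneousIdeal.toIdeal_irrelevant_le _).mpr fun i hi f hf => ?_) ?_
  · rw [Submodule.mem_toAddSubmonoid, ← pow_one (idealOfVars _ _), mem_pow_idealOfVars_iff]
    intro x hx
    have hdeg : x.degree = i := IsHomogeneous.degree_eq_sum_deg_support hf hx |>.symm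
    omega
  · rw [Ideal.span_le]
    rintro _ ⟨i, rfl⟩
    exact HomogeneousIdeal.mem_irrelevant_of_mem _ one_pos (isHomogeneous_X k i)

lemma exists_X_notMem (p : ProjectiveSpectrum (stdGrading k n)) :
    ∃ i, X i ∉ p.asHomogeneousIdeal := by
  by_contra! h
  refine p.not_irrelevant_le (toIdeal_irrelevant_stdGrading.trans_le (Ideal.span_le.mpr ?_))
  rintro _ ⟨i, rfl⟩
  exact h i

namespace HasCoordinates

variable {p q : ProjectiveSpectrum (stdGrading k n)} {a : Fin (n + 1) → k}

lemma mem_iff (h : HasCoordinates p a) {G : MvPolynomial (Fin (n + 1)) k} {e : ℕ}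
    (hG : G.IsHomogeneous e) : G ∈ p.asHomogeneousIdeal ↔ eval a G = 0 := by
  rw [h, mem_tangentIdeal_zero_iff hG]

lemma ne_zero (h : HasCoordinates p a) : a ≠ 0 := by
  rintro rfl
  obtain ⟨i, hi⟩ := exists_X_notMem p
  exact hi ((h.mem_iff (isHomogeneous_X k i)).mpr (by simp))

lemma mk_X_eq (h : HasCoordinates p a) {I : Ideal (MvPolynomial (Fin (n + 1)) k)}
    (hpI : p.asHomogeneousIdeal.toIdeal ≤ I) {l : MvPolynomial (Fin (n + 1)) k}
    (hl : l.IsHomogeneous 1) (hla : eval a l = 1) (i : Fin (n + 1)) :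
    Ideal.Quotient.mk I (X i) = Ideal.Quotient.mk I l * algebraMap k _ (a i) := by
  have hmem : X i - C (a i) * l ∈ I := hpI <|
    (h.mem_iff ((isHomogeneous_X k i).sub (hl.C_mul (a i)))).mpr (by simp [hla])
  rw [mul_comm]
  exact Ideal.Quotient.eq.mpr hmem

lemma mk_eq_pow_mul (h : HasCoordinates p a) {I : Ideal (MvPolynomial (Fin (n + 1)) k)}
    (hpI : p.asHomogeneousIdeal.toIdeal ≤ I) {l G : MvPolynomial (Fin (n + 1)) k}
    (hl : l.IsHomogeneous 1) (hla : eval a l = 1) {e : ℕ} (hG : G.IsHomogeneous e) :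
    Ideal.Quotient.mk I G = Ideal.Quotient.mk I l ^ e * algebraMap k _ (eval a G) := by
  have hmk : Ideal.Quotient.mkₐ k I = aeval fun i => Ideal.Quotient.mk I l * algebraMap k _ (a i) :=
    algHom_ext fun i => by simpa using h.mk_X_eq hpI hl hla i
  calc Ideal.Quotient.mk I G
      = aeval (fun i => Ideal.Quotient.mk I l * algebraMap k _ (a i)) G := DFunLike.congr_fun hmk G
    _ = Ideal.Quotient.mk I l ^ e * aeval (fun i => algebraMap k _ (a i)) G :=
      aeval_mul_of_isHomogeneous hG _ _
    _ = Ideal.Quotient.mk I l ^ e * algebraMap k _ (eval a G) := by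
      rw [← aeval_eq_eval]
      exact congrArg _ (aeval_algebraMap_apply _ a G)

lemma eq_of_le (h : HasCoordinates p a) (hpq : p.asHomogeneousIdeal ≤ q.asHomogeneousIdeal) :
    q = p := by
  obtain ⟨l, hl, hla⟩ := exists_isHomogeneous_one_eval_eq_one h.ne_zero
  have hlq : Ideal.Quotient.mk q.asHomogeneousIdeal.toIdeal l ≠ 0 := by
    intro hl0
    obtain ⟨i, hi⟩ := exists_X_notMem q
    refine hi (Ideal.Quotient.eq_zero_iff_mem.mp ?_)
    rw [h.mk_X_eq hpq hl hla, hl0, zero_mul]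
  refine ProjectiveSpectrum.ext (le_antisymm ?_ hpq)
  refine homogeneousIdeal_le_of_forall_homogeneous_mem fun e G hG hGq => ?_
  have hG0 := h.mk_eq_pow_mul hpq hl hla hG
  rw [Ideal.Quotient.eq_zero_iff_mem.mpr hGq, eq_comm, mul_eq_zero,
    or_iff_right (pow_ne_zero _ hlq), map_eq_zero] at hG0
  exact (h.mem_iff hG).mpr hG0

end HasCoordinates

lemma exists_hasCoordinates {a : Fin (n + 1) → k} (ha : a ≠ 0) :
    ∃ p : ProjectiveSpectrum (stdGrading k n), HasCoordinates p a := by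
  refine ⟨⟨tangentIdeal a 0, isPrime_tangentIdeal_zero a, fun h => ha (funext fun i => ?_)⟩, rfl⟩
  simpa using eval_eq_zero_of_mem_tangentIdeal
    (h (HomogeneousIdeal.mem_irrelevant_of_mem _ one_pos (isHomogeneous_X k i)))

lemma mem_radical_of_forall_hasCoordinates [IsAlgClosed k] {I : HomogeneousIdeal (stdGrading k n)}
    {f : MvPolynomial (Fin (n + 1)) k} (hf : f ∈ idealOfVars (Fin (n + 1)) k)
    (h : ∀ (q : ProjectiveSpectrum (stdGrading k n)) (a : Fin (n + 1) → k), HasCoordinates q a →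
      I ≤ q.asHomogeneousIdeal → f ∈ q.asHomogeneousIdeal) : f ∈ I.toIdeal.radical := by
  rw [← vanishingIdeal_zeroLocus_eq_radical (K := k), mem_vanishingIdeal_iff]
  intro x hx
  rw [aeval_eq_eval]
  rcases eq_or_ne x 0 with rfl | hx0
  · have hle : idealOfVars (Fin (n + 1)) k ≤ RingHom.ker (eval 0) := by
      rw [Ideal.span_le]
      rintro _ ⟨i, rfl⟩
      simp
    exact hle hf
  · obtain ⟨q, hq⟩ := exists_hasCoordinates hx0
    have hIq : I ≤ q.asHomogeneousIdeal :=
      homogeneousIdeal_le_of_forall_homogeneous_mem fun e G hG hGI => (hq.mem_iff hG).mpr <| by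
        simpa [aeval_eq_eval] using hx G hGI
    have hfq := h q x hq hIq
    rw [hq] at hfq
    exact eval_eq_zero_of_mem_tangentIdeal hfq

namespace ZeroDimScheme

variable (Z : ZeroDimScheme k n)

lemma mem_points {Z : ZeroDimScheme k n} {p : ProjectiveSpectrum (stdGrading k n)} :
    p ∈ Z.points ↔ Z.ideal ≤ p.asHomogeneousIdeal := by
  simp only [points, Set.Finite.mem_toFinset, ProjectiveSpectrum.mem_zeroLocus]
  rfl

lemma exists_hasCoordinates_of_mem_points [IsAlgClosed k]
    {p : ProjectiveSpectrum (stdGrading k n)} (hp : p ∈ Z.points) : ∃ a, HasCoordinates p a := by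
  classical
  set S := Z.points.filter fun q => ∃ a, HasCoordinates q a
  have hle : idealOfVars (Fin (n + 1)) k ⊓ S.inf (fun q => q.asHomogeneousIdeal.toIdeal) ≤
      p.asHomogeneousIdeal.toIdeal := by
    rintro f ⟨hf, hfS⟩
    rw [SetLike.mem_coe, Submodule.mem_finsetInf] at hfS
    rw [← p.isPrime.radical]
    exact mem_radical_of_forall_hasCoordinates hf fun q a hq hpq =>
      hfS q (Finset.mem_filter.mpr ⟨mem_points.mpr ((mem_points.mp hp).trans hpq), a, hq⟩)
  rcases p.isPrime.inf_le.mp hle with hX | hS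
  · obtain ⟨i, hi⟩ := exists_X_notMem p
    exact absurd (hX (Ideal.subset_span ⟨i, rfl⟩)) hi
  · obtain ⟨q, hq, hqp⟩ := p.isPrime.inf_le'.mp hS
    obtain ⟨a, ha⟩ := (Finset.mem_filter.mp hq).2
    exact ⟨a, ha.eq_of_le hqp ▸ ha⟩

lemma mem_of_pow_idealOfVars_le_colon (N : ℕ) {f : MvPolynomial (Fin (n + 1)) k}
    (h : idealOfVars (Fin (n + 1)) k ^ N ≤ Z.ideal.toIdeal.colon {f}) : f ∈ Z.ideal := by
  induction N generalizing f with
  | zero => simpa using h (show (1 : MvPolynomial (Fin (n + 1)) k) ∈ _ by simp)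
  | succ N ih =>
    refine Z.saturated f fun i => ih fun g hg => ?_
    have hgX : g * X i ∈ Z.ideal.toIdeal.colon {f} :=
      h (pow_succ (idealOfVars _ k) N ▸ Ideal.mul_mem_mul hg (Ideal.subset_span ⟨i, rfl⟩))
    rw [Submodule.mem_colon_singleton] at hgX ⊢
    simpa [mul_assoc] using hgX

/-- The homogeneous ideal of the component of `Z` at `p`, that is, the contraction of the extension
of `I(Z)` to the localization at `p`. (This contraction is homogeneous; taking its homogeneous core
avoids having to prove it.) -/
def componentIdeal (p : ProjectiveSpectrum (stdGrading k n)) :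
    HomogeneousIdeal (stdGrading k n) :=
  ((Z.ideal.toIdeal.map (algebraMap _ (Localization.AtPrime p.asHomogeneousIdeal.toIdeal))).comap
    (algebraMap _ _)).homogeneousCore (stdGrading k n)

variable {Z} {p : ProjectiveSpectrum (stdGrading k n)} {f : MvPolynomial (Fin (n + 1)) k} {e : ℕ}

lemma mem_componentIdeal_iff_algebraMap_mem (hf : f.IsHomogeneous e) :
    f ∈ Z.componentIdeal p ↔ algebraMap _ (Localization.AtPrime p.asHomogeneousIdeal.toIdeal) f ∈
      Z.ideal.toIdeal.map (algebraMap _ (Localization.AtPrime p.asHomogeneousIdeal.toIdeal)) :=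
  (mem_homogeneousCore_iff_of_mem hf).trans Ideal.mem_comap

lemma mem_componentIdeal_iff (hf : f.IsHomogeneous e) :
    f ∈ Z.componentIdeal p ↔ ∃ s ∉ p.asHomogeneousIdeal, s * f ∈ Z.ideal := by
  rw [mem_componentIdeal_iff_algebraMap_mem hf,
    IsLocalization.algebraMap_mem_map_algebraMap_iff p.asHomogeneousIdeal.toIdeal.primeCompl]
  rfl

lemma ideal_eq_inf_componentIdeal [IsAlgClosed k] (Z : ZeroDimScheme k n) :
    Z.ideal = Z.points.inf Z.componentIdeal := by
  refine le_antisymm (Finset.le_inf fun p _ => ?_) ?_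
  · exact homogeneousIdeal_le_of_forall_homogeneous_mem fun e f hf hfZ =>
      (mem_componentIdeal_iff hf).mpr ⟨1, p.isPrime.one_notMem, by simpa using hfZ⟩
  refine homogeneousIdeal_le_of_forall_homogeneous_mem fun e f hf hfZ => ?_
  let J : HomogeneousIdeal (stdGrading k n) :=
    ⟨Z.ideal.toIdeal.colon {f}, isHomogeneous_colon_singleton Z.ideal.isHomogeneous hf⟩
  have hJ : idealOfVars (Fin (n + 1)) k ≤ J.toIdeal.radical := by
    intro g hg
    refine mem_radical_of_forall_hasCoordinates hg fun q a _ hJq => ?_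
    have hq : q ∈ Z.points := mem_points.mpr fun g hg => hJq <|
      Submodule.mem_colon_singleton.mpr (Ideal.mul_mem_right _ _ hg)
    obtain ⟨s, hsq, hs⟩ :=
      (mem_componentIdeal_iff hf).mp (Finset.inf_le (f := Z.componentIdeal) hq hfZ)
    exact absurd (hJq (Submodule.mem_colon_singleton.mpr hs)) hsq
  obtain ⟨N, hN⟩ := Ideal.exists_pow_le_of_le_radical_of_fg hJ (idealOfVars_fg _ _)
  exact Z.mem_of_pow_idealOfVars_le_colon N hN

end ZeroDimScheme

end RationalPoints

section LocalAlgebra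

open IsLocalRing DualNumber

section Length

variable {A : Type*} [CommRing A]

lemma length_quotient_add_one_le {I J : Ideal A} (h : I < J) :
    Module.length A (A ⧸ J) + 1 ≤ Module.length A (A ⧸ I) := by
  rw [Module.length_quotient, Module.length_quotient]
  exact Order.coheight_add_one_le h

lemma length_quotient_maximalIdeal [IsLocalRing A] :
    Module.length A (A ⧸ maximalIdeal A) = 1 :=
  Module.length_eq_one_iff.mpr (isSimpleModule_iff_isCoatom.mpr (maximalIdeal.isMaximal A).out)

lemma length_quotient_le_card {k : Type*} [Field k] [Algebra k A] {I : Ideal A} (s : Finset A)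
    (hs : ∀ y, ∃ z ∈ Submodule.span k (s : Set A), y - z ∈ I) :
    Module.length A (A ⧸ I) ≤ s.card := by
  have hsurj : Function.Surjective
      ((Ideal.Quotient.mkₐ k I).toLinearMap ∘ₗ (Submodule.span k (s : Set A)).subtype) :=
    Ideal.Quotient.mk_surjective.forall.mpr fun y => by
      obtain ⟨z, hz, hyz⟩ := hs y
      exact ⟨⟨z, hz⟩, (Ideal.Quotient.eq.mpr hyz).symm⟩
  calc Module.length A (A ⧸ I) ≤ Module.length k (A ⧸ I) := by
        rw [← Module.length_top (R := A), ← Module.length_top (R := k)]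
        exact Submodule.length_le_length_restrictScalars k (⊤ : Submodule A (A ⧸ I))
    _ ≤ Module.length k (Submodule.span k (s : Set A)) := Module.length_le_of_surjective _ hsurj
    _ = Module.finrank k (Submodule.span k (s : Set A)) := Module.length_eq_finrank _ _
    _ ≤ s.card := by exact_mod_cast finrank_span_finset_le_card s

end Length

variable {k A : Type*} [Field k] [CommRing A] [IsLocalRing A] {I : Ideal A}

lemma span_singleton_sup_eq_maximalIdeal (hlen : Module.length A (A ⧸ I) ≤ 2)
    (hI : I ≤ maximalIdeal A) {x : A} (hx : x ∈ maximalIdeal A) (hxI : x ∉ I) :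
    Ideal.span {x} ⊔ I = maximalIdeal A := by
  have hlt : I < Ideal.span {x} ⊔ I := right_lt_sup.mpr fun h =>
    hxI (h (Ideal.mem_span_singleton_self x))
  have hle : Ideal.span {x} ⊔ I ≤ maximalIdeal A :=
    sup_le ((Ideal.span_singleton_le_iff_mem _).mpr hx) hI
  by_contra hne
  have h2 := length_quotient_add_one_le (hle.lt_of_ne hne)
  rw [length_quotient_maximalIdeal] at h2
  have h3 : (1 : ℕ∞) + 1 + 1 ≤ 2 :=
    (add_le_add_left h2 1).trans ((length_quotient_add_one_le hlt).trans hlen)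
  exact absurd h3 (by decide)

lemma mul_mem_of_length_quotient_le_two (hlen : Module.length A (A ⧸ I) ≤ 2)
    (hI : I ≤ maximalIdeal A) {y z : A} (hy : y ∈ maximalIdeal A) (hz : z ∈ maximalIdeal A) :
    y * z ∈ I := by
  by_contra hyz
  rw [← span_singleton_sup_eq_maximalIdeal hlen hI (Ideal.mul_mem_right z _ hy) hyz,
    Ideal.mem_span_singleton_sup] at hy
  obtain ⟨r, b, hb, hy⟩ := hy
  have hunit : IsUnit (1 - r * z) :=
    isUnit_one_sub_self_of_mem_nonunits _ (Ideal.mul_mem_left _ r hz)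
  have hyI : y ∈ I := (Ideal.unit_mul_mem_iff_mem I hunit).mp <| by
    rwa [show (1 - r * z) * y = b by linear_combination - hy]
  exact hyz (Ideal.mul_mem_right z I hyI)

variable [Algebra k A]

lemma exists_dualNumber_algEquiv_quotient
    (hres : ∀ r : A, ∃ c : k, r - algebraMap k A c ∈ maximalIdeal A)
    (hlen : Module.length A (A ⧸ I) ≤ 2) (hI : I < maximalIdeal A) :
    Nonempty (k[ε] ≃ₐ[k] A ⧸ I) := by
  obtain ⟨x, hx, hxI⟩ := SetLike.exists_of_lt hI
  have hxx : Ideal.Quotient.mk I x * Ideal.Quotient.mk I x = 0 := by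
    rw [← map_mul]
    exact Ideal.Quotient.eq_zero_iff_mem.mpr (mul_mem_of_length_quotient_le_two hlen hI.le hx hx)
  let φ : k[ε] →ₐ[k] A ⧸ I :=
    DualNumber.lift ⟨⟨Algebra.ofId k _, Ideal.Quotient.mk I x⟩, hxx, fun _ => Commute.all _ _⟩
  have hφ (c d : k) : φ (TrivSqZeroExt.inl c + TrivSqZeroExt.inr d) =
      Ideal.Quotient.mk I (algebraMap k A c + algebraMap k A d * x) := by
    simp [φ, DualNumber.lift_apply_apply, Algebra.ofId_apply]
  have hunit {c : k} (hc : algebraMap k A c ∈ maximalIdeal A) : c = 0 := by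
    by_contra hc0
    exact (mem_maximalIdeal _).mp hc ((IsUnit.mk0 c hc0).map _)
  refine ⟨AlgEquiv.ofBijective φ ⟨(injective_iff_map_eq_zero φ).mpr fun w hw => ?_, ?_⟩⟩
  · rw [← TrivSqZeroExt.inl_fst_add_inr_snd_eq w, hφ, Ideal.Quotient.eq_zero_iff_mem] at hw
    have hfst : w.fst = 0 :=
      hunit ((Ideal.add_mem_iff_left _ (Ideal.mul_mem_left _ _ hx)).mp (hI.le hw))
    rw [hfst, map_zero, zero_add] at hw
    have hsnd : w.snd = 0 := by
      by_contra h
      exact hxI ((Ideal.unit_mul_mem_iff_mem I ((IsUnit.mk0 _ h).map _)).mp hw)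
    exact TrivSqZeroExt.ext hfst hsnd
  · refine Ideal.Quotient.mk_surjective.forall.mpr fun y => ?_
    obtain ⟨c, hc⟩ := hres y
    rw [← span_singleton_sup_eq_maximalIdeal hlen hI.le hx hxI,
      Ideal.mem_span_singleton_sup] at hc
    obtain ⟨r, b, hb, hy⟩ := hc
    obtain ⟨d, hd⟩ := hres r
    refine ⟨TrivSqZeroExt.inl c + TrivSqZeroExt.inr d, ?_⟩
    rw [hφ, eq_comm, Ideal.Quotient.eq]
    convert I.add_mem hb (mul_mem_of_length_quotient_le_two hlen hI.le hd hx) using 1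
    linear_combination - hy

end LocalAlgebra

section HomogeneousLocalization

variable {ι R B : Type*} [AddCommMonoid ι] [DecidableEq ι] [CommRing R] [CommRing B] [Algebra R B]

instance (𝒜 : ι → Submodule R B) [GradedAlgebra 𝒜]
    (x : Submonoid B) : Algebra R (HomogeneousLocalization 𝒜 x) where
  algebraMap := (algebraMap (𝒜 0) (HomogeneousLocalization 𝒜 x)).comp (algebraMap R (𝒜 0))
  commutes' _ _ := mul_comm _ _
  smul_def' r f := by
    apply HomogeneousLocalization.val_injective
    rw [HomogeneousLocalization.val_smul, HomogeneousLocalization.val_mul, Algebra.smul_def]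
    rfl

instance (𝒜 : ι → Submodule R B) [GradedAlgebra 𝒜] (x : Submonoid B) :
    IsScalarTower R (HomogeneousLocalization 𝒜 x) (Localization x) :=
  ⟨fun r f t => by
    change (r • f).val * t = r • (f.val * t)
    rw [HomogeneousLocalization.val_smul, smul_mul_assoc]⟩

end HomogeneousLocalization

section LocalRing

open IsLocalRing

variable {k : Type*} [Field k] {n : ℕ} {p : ProjectiveSpectrum (stdGrading k n)}
  {a : Fin (n + 1) → k} {s g : MvPolynomial (Fin (n + 1)) k} {e : ℕ}

lemma mem_comap_algebraMap_iff_of_smul_val_eq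
    {J : Ideal (Localization.AtPrime p.asHomogeneousIdeal.toIdeal)}
    {f : ZeroDimScheme.LocalRingAt p} (hs : s ∉ p.asHomogeneousIdeal)
    (h : s • f.val = algebraMap _ _ g) :
    f ∈ J.comap (algebraMap (ZeroDimScheme.LocalRingAt p) _) ↔ algebraMap _ _ g ∈ J := by
  have hunit : IsUnit (algebraMap _ (Localization.AtPrime p.asHomogeneousIdeal.toIdeal) s) :=
    IsLocalization.map_units _ (⟨s, hs⟩ : p.asHomogeneousIdeal.toIdeal.primeCompl)
  rw [← h, Algebra.smul_def, Ideal.unit_mul_mem_iff_mem J hunit]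
  rfl

lemma mem_stalkIdeal_iff_of_smul_val_eq {Z : ZeroDimScheme k n} {f : ZeroDimScheme.LocalRingAt p}
    (hs : s ∉ p.asHomogeneousIdeal) (hg : g.IsHomogeneous e) (h : s • f.val = algebraMap _ _ g) :
    f ∈ Z.stalkIdeal p ↔ g ∈ Z.componentIdeal p := by
  rw [ZeroDimScheme.mem_componentIdeal_iff_algebraMap_mem hg]
  exact mem_comap_algebraMap_iff_of_smul_val_eq hs h

lemma mem_maximalIdeal_iff_of_smul_val_eq {f : ZeroDimScheme.LocalRingAt p}
    (hs : s ∉ p.asHomogeneousIdeal) (h : s • f.val = algebraMap _ _ g) :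
    f ∈ maximalIdeal (ZeroDimScheme.LocalRingAt p) ↔ g ∈ p.asHomogeneousIdeal := by
  have hcomap : f ∈ maximalIdeal (ZeroDimScheme.LocalRingAt p) ↔
      f ∈ (maximalIdeal (Localization.AtPrime p.asHomogeneousIdeal.toIdeal)).comap
        (algebraMap (ZeroDimScheme.LocalRingAt p) _) := by
    rw [Ideal.mem_comap, mem_maximalIdeal, mem_maximalIdeal, mem_nonunits_iff, mem_nonunits_iff,
      ← HomogeneousLocalization.isUnit_iff_isUnit_val]
    rfl
  rw [hcomap, mem_comap_algebraMap_iff_of_smul_val_eq hs h]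
  exact IsLocalization.AtPrime.to_map_mem_maximal_iff _ p.asHomogeneousIdeal.toIdeal g

lemma exists_smul_val_eq (f : ZeroDimScheme.LocalRingAt p) :
    ∃ (e : ℕ) (s g : MvPolynomial (Fin (n + 1)) k), s.IsHomogeneous e ∧ g.IsHomogeneous e ∧
      s ∉ p.asHomogeneousIdeal ∧ s • f.val = algebraMap _ _ g :=
  ⟨f.deg, f.den, f.num, f.den_mem_deg, f.num_mem_deg, f.den_mem, f.den_smul_val⟩

lemma smul_val_sub_smul {f x : ZeroDimScheme.LocalRingAt p} {s' g' : MvPolynomial (Fin (n + 1)) k}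
    (hf : s • f.val = algebraMap _ _ g) (hx : s' • x.val = algebraMap _ _ g') (c : k) :
    (s * s') • (f - c • x).val = algebraMap _ _ (s' * g - C c * (s * g')) := by
  have hc : c • x.val = C c • x.val := (algebraMap_smul (MvPolynomial (Fin (n + 1)) k) c x.val).symm
  rw [map_sub, map_mul, map_mul, map_mul, ← hf, ← hx, HomogeneousLocalization.val_sub,
    HomogeneousLocalization.val_smul, hc]
  simp only [Algebra.smul_def, map_mul]
  ring

lemma smul_val_sub_algebraMap {f : ZeroDimScheme.LocalRingAt p} (hf : s • f.val = algebraMap _ _ g)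
    (c : k) : s • (f - algebraMap k _ c).val = algebraMap _ _ (g - C c * s) := by
  have hone : (1 : MvPolynomial (Fin (n + 1)) k) • (1 : ZeroDimScheme.LocalRingAt p).val =
      algebraMap _ _ (1 : MvPolynomial (Fin (n + 1)) k) := by
    simp
  simpa only [mul_one, one_mul, Algebra.algebraMap_eq_smul_one] using smul_val_sub_smul hf hone c

lemma HasCoordinates.exists_sub_algebraMap_mem_maximalIdeal (h : HasCoordinates p a)
    (f : ZeroDimScheme.LocalRingAt p) :
    ∃ c : k, f - algebraMap k _ c ∈ maximalIdeal (ZeroDimScheme.LocalRingAt p) := by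
  obtain ⟨e, s, g, hs, hg, hsp, hf⟩ := exists_smul_val_eq f
  have hsa : eval a s ≠ 0 := (h.mem_iff hs).not.mp hsp
  refine ⟨eval a g / eval a s, ?_⟩
  rw [mem_maximalIdeal_iff_of_smul_val_eq hsp (smul_val_sub_algebraMap hf _),
    h.mem_iff (hg.sub (hs.C_mul _))]
  simp [hsa]

end LocalRing

section AffineCoordinates

open IsLocalRing DualNumber

variable {k : Type*} [Field k] {n : ℕ} {p : ProjectiveSpectrum (stdGrading k n)}
  {a : Fin (n + 1) → k} {l G : MvPolynomial (Fin (n + 1)) k} {e : ℕ}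

/-- The affine coordinates `X_i / l` at `p`, where `l` is a linear form that does not vanish at
`p`. -/
def affineCoord (hl : l.IsHomogeneous 1) (hlp : l ∉ p.asHomogeneousIdeal) (i : Fin (n + 1)) :
    ZeroDimScheme.LocalRingAt p :=
  HomogeneousLocalization.mk ⟨1, ⟨X i, isHomogeneous_X k i⟩, ⟨l, hl⟩, hlp⟩

lemma smul_val_affineCoord (hl : l.IsHomogeneous 1) (hlp : l ∉ p.asHomogeneousIdeal)
    (i : Fin (n + 1)) : l • (affineCoord hl hlp i).val =
      algebraMap (MvPolynomial (Fin (n + 1)) k)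
        (Localization.AtPrime p.asHomogeneousIdeal.toIdeal) (X i) := by
  rw [affineCoord, HomogeneousLocalization.val_mk, Localization.mk_eq_mk', Algebra.smul_def]
  exact IsLocalization.mk'_spec' (Localization.AtPrime p.asHomogeneousIdeal.toIdeal) (X i)
    (⟨l, hlp⟩ : p.asHomogeneousIdeal.toIdeal.primeCompl)

lemma pow_smul_val_aeval_affineCoord (hl : l.IsHomogeneous 1) (hlp : l ∉ p.asHomogeneousIdeal)
    (hG : G.IsHomogeneous e) :
    l ^ e • (aeval (affineCoord hl hlp) G).val =
      algebraMap _ (Localization.AtPrime p.asHomogeneousIdeal.toIdeal) G := by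
  have hval : (aeval (affineCoord hl hlp) G).val =
      aeval (fun i => (affineCoord hl hlp i).val) G :=
    comp_aeval_apply _ (IsScalarTower.toAlgHom k (ZeroDimScheme.LocalRingAt p)
        (Localization.AtPrime p.asHomogeneousIdeal.toIdeal)) G
  rw [Algebra.smul_def, map_pow, hval, ← aeval_mul_of_isHomogeneous hG]
  simp only [← Algebra.smul_def, smul_val_affineCoord]
  exact (DFunLike.congr_fun (aeval_unique (IsScalarTower.toAlgHom k _
    (Localization.AtPrime p.asHomogeneousIdeal.toIdeal))) G).symm

lemma aeval_affineCoord_mem_maximalIdeal_iff (hl : l.IsHomogeneous 1)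
    (hlp : l ∉ p.asHomogeneousIdeal) (hG : G.IsHomogeneous e) :
    aeval (affineCoord hl hlp) G ∈ maximalIdeal (ZeroDimScheme.LocalRingAt p) ↔
      G ∈ p.asHomogeneousIdeal :=
  mem_maximalIdeal_iff_of_smul_val_eq (fun h => hlp (p.isPrime.mem_of_pow_mem e h))
    (pow_smul_val_aeval_affineCoord hl hlp hG)

lemma aeval_affineCoord_mem_stalkIdeal_iff (Z : ZeroDimScheme k n) (hl : l.IsHomogeneous 1)
    (hlp : l ∉ p.asHomogeneousIdeal) (hG : G.IsHomogeneous e) :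
    aeval (affineCoord hl hlp) G ∈ Z.stalkIdeal p ↔ G ∈ Z.componentIdeal p :=
  mem_stalkIdeal_iff_of_smul_val_eq (fun h => hlp (p.isPrime.mem_of_pow_mem e h)) hG
    (pow_smul_val_aeval_affineCoord hl hlp hG)

lemma HasCoordinates.affineCoord_sub_algebraMap_mem_maximalIdeal (h : HasCoordinates p a)
    (hl : l.IsHomogeneous 1) (hlp : l ∉ p.asHomogeneousIdeal) (hla : eval a l = 1)
    (i : Fin (n + 1)) :
    affineCoord hl hlp i - algebraMap k _ (a i) ∈ maximalIdeal (ZeroDimScheme.LocalRingAt p) := by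
  rw [mem_maximalIdeal_iff_of_smul_val_eq hlp
    (smul_val_sub_algebraMap (smul_val_affineCoord hl hlp i) _),
    h.mem_iff ((isHomogeneous_X k i).sub (hl.C_mul _))]
  simp [hla]

lemma HasCoordinates.exists_algHom_comp_aeval_affineCoord_eq_dualEval (h : HasCoordinates p a)
    (hl : l.IsHomogeneous 1) (hlp : l ∉ p.asHomogeneousIdeal) (hla : eval a l = 1)
    (δ : ZeroDimScheme.LocalRingAt p →ₐ[k] k[ε]) :
    ∃ v, δ.comp (aeval (affineCoord hl hlp)) = dualEval a v := by
  have hker : RingHom.ker ((TrivSqZeroExt.fstHom k k k).comp δ) =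
      maximalIdeal (ZeroDimScheme.LocalRingAt p) :=
    ker_eq_maximalIdeal _ fun c => ⟨algebraMap k _ c, AlgHom.commutes _ c⟩
  refine ⟨fun i => (δ (affineCoord hl hlp i)).snd, algHom_ext fun i => ?_⟩
  have hfst : (δ (affineCoord hl hlp i - algebraMap k _ (a i))).fst = 0 := by
    have hmem := h.affineCoord_sub_algebraMap_mem_maximalIdeal hl hlp hla i
    rwa [← hker] at hmem
  rw [map_sub, AlgHom.commutes, TrivSqZeroExt.fst_sub, sub_eq_zero] at hfst
  refine TrivSqZeroExt.ext ?_ ?_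
  · simpa [dualEval, TrivSqZeroExt.algebraMap_eq_inl] using hfst
  · simp [dualEval]

end AffineCoordinates

section TangentLength

variable {k σ : Type*} [Field k]

/-- The length of the scheme cut out by `tangentIdeal a v` for `a ≠ 0`, provided that `v` is not a
nonzero multiple of `a`: it is `1` for `v = 0` and `2` otherwise. -/
def tangentLength (v : σ → k) : ℕ :=
  1 + Module.finrank k (Submodule.span k {v})

@[simp]
lemma tangentLength_zero : tangentLength (0 : σ → k) = 1 := by
  simp [tangentLength]

lemma tangentLength_of_ne_zero {v : σ → k} (hv : v ≠ 0) : tangentLength v = 2 := by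
  rw [tangentLength, finrank_span_singleton hv]

lemma tangentLength_le_two (v : σ → k) : tangentLength v ≤ 2 := by
  rcases eq_or_ne v 0 with rfl | hv
  · simp
  · exact (tangentLength_of_ne_zero hv).le

end TangentLength

section LocalStructure

open IsLocalRing

variable {k : Type*} [Field k] {n : ℕ} {p : ProjectiveSpectrum (stdGrading k n)}
  {a v : Fin (n + 1) → k} {Z : ZeroDimScheme k n}

lemma componentIdeal_le_of_mem_points (hp : p ∈ Z.points) :
    Z.componentIdeal p ≤ p.asHomogeneousIdeal :=
  homogeneousIdeal_le_of_forall_homogeneous_mem fun e f hf hfp => by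
    obtain ⟨s, hs, hsf⟩ := (ZeroDimScheme.mem_componentIdeal_iff hf).mp hfp
    exact (p.isPrime.mem_or_mem (ZeroDimScheme.mem_points.mp hp hsf)).resolve_left hs

lemma stalkIdeal_le_maximalIdeal (hp : p ∈ Z.points) :
    Z.stalkIdeal p ≤ maximalIdeal (ZeroDimScheme.LocalRingAt p) := fun f hf => by
  obtain ⟨e, s, g, -, hg, hsp, hfrac⟩ := exists_smul_val_eq f
  rw [mem_stalkIdeal_iff_of_smul_val_eq hsp hg hfrac] at hf
  exact (mem_maximalIdeal_iff_of_smul_val_eq hsp hfrac).mpr (componentIdeal_le_of_mem_points hp hf)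

lemma HasCoordinates.exists_componentIdeal_eq_tangentIdeal (h : HasCoordinates p a)
    (hp : p ∈ Z.points) (hlen : Z.localLength p ≤ 2) :
    ∃ v, Z.componentIdeal p = tangentIdeal a v ∧ tangentLength v ≤ Z.localLength p := by
  obtain ⟨l, hl, hla⟩ := exists_isHomogeneous_one_eval_eq_one h.ne_zero
  have hlp : l ∉ p.asHomogeneousIdeal := (h.mem_iff hl).not.mpr (by simp [hla])
  rcases (stalkIdeal_le_maximalIdeal hp).eq_or_lt with hI | hI
  · refine ⟨0, (componentIdeal_le_of_mem_points hp).trans_eq h |>.antisymm ?_, ?_⟩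
    · refine homogeneousIdeal_le_of_forall_homogeneous_mem fun e G hG hGa => ?_
      rwa [← h, ← aeval_affineCoord_mem_maximalIdeal_iff hl hlp hG, ← hI,
        aeval_affineCoord_mem_stalkIdeal_iff Z hl hlp hG] at hGa
    · rw [ZeroDimScheme.localLength, hI, length_quotient_maximalIdeal, tangentLength_zero,
        Nat.cast_one]
  · obtain ⟨φ⟩ := exists_dualNumber_algEquiv_quotient h.exists_sub_algebraMap_mem_maximalIdeal
      hlen hI
    obtain ⟨v, hv⟩ := h.exists_algHom_comp_aeval_affineCoord_eq_dualEval hl hlp hla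
      (φ.symm.toAlgHom.comp (Ideal.Quotient.mkₐ k (Z.stalkIdeal p)))
    have hmem {e : ℕ} {G : MvPolynomial (Fin (n + 1)) k} (hG : G.IsHomogeneous e) :
        G ∈ Z.componentIdeal p ↔ G ∈ tangentIdeal a v := by
      rw [mem_tangentIdeal_iff hG, ← dualEval_eq_zero_iff, ← hv,
        ← aeval_affineCoord_mem_stalkIdeal_iff Z hl hlp hG, ← Ideal.Quotient.eq_zero_iff_mem]
      exact (map_eq_zero_iff φ.symm φ.symm.injective).symm
    refine ⟨v, le_antisymm ?_ ?_, ?_⟩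
    · exact homogeneousIdeal_le_of_forall_homogeneous_mem fun _ _ hG => (hmem hG).mp
    · exact homogeneousIdeal_le_of_forall_homogeneous_mem fun _ _ hG => (hmem hG).mpr
    · calc (tangentLength v : ℕ∞) ≤ 1 + 1 := by exact_mod_cast tangentLength_le_two v
        _ ≤ Z.localLength p := length_quotient_maximalIdeal (A := ZeroDimScheme.LocalRingAt p) ▸
          length_quotient_add_one_le hI

lemma HasCoordinates.exists_sub_smul_mem_stalkIdeal (h : HasCoordinates p a)
    (hv : tangentIdeal a v ≤ Z.componentIdeal p) {x y : ZeroDimScheme.LocalRingAt p}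
    (hx : x ∈ maximalIdeal (ZeroDimScheme.LocalRingAt p)) (hxI : x ∉ Z.stalkIdeal p)
    (hy : y ∈ maximalIdeal (ZeroDimScheme.LocalRingAt p)) :
    ∃ t : k, y - t • x ∈ Z.stalkIdeal p := by
  obtain ⟨e, s, g, hs, hg, hsp, hxfrac⟩ := exists_smul_val_eq x
  obtain ⟨e', s', g', hs', hg', hsp', hyfrac⟩ := exists_smul_val_eq y
  rw [mem_maximalIdeal_iff_of_smul_val_eq hsp hxfrac, h.mem_iff hg] at hx
  rw [mem_maximalIdeal_iff_of_smul_val_eq hsp' hyfrac, h.mem_iff hg'] at hy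
  have hsa' : eval a s' ≠ 0 := (h.mem_iff hs').not.mp hsp'
  have hxv : dirDeriv a v g ≠ 0 := fun hxv =>
    hxI ((mem_stalkIdeal_iff_of_smul_val_eq hsp hg hxfrac).mpr
      (hv ((mem_tangentIdeal_iff hg).mpr ⟨hx, hxv⟩)))
  refine ⟨eval a s * dirDeriv a v g' / (eval a s' * dirDeriv a v g), ?_⟩
  have hform := (hs.mul hg').sub ((add_comm e' e ▸ hs'.mul hg).C_mul
    (eval a s * dirDeriv a v g' / (eval a s' * dirDeriv a v g)))
  refine (mem_stalkIdeal_iff_of_smul_val_eq (fun hmem =>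
    (p.isPrime.mem_or_mem hmem).elim hsp' hsp) hform (smul_val_sub_smul hyfrac hxfrac _)).mpr
      (hv ((mem_tangentIdeal_iff hform).mpr ⟨by simp [hx, hy], ?_⟩))
  rw [← smul_eq_C_mul]
  simp only [map_sub, map_smul, dirDeriv_mul, hx, hy, mul_zero, add_zero, smul_eq_mul]
  field_simp
  ring

lemma maximalIdeal_le_stalkIdeal (hp : p.asHomogeneousIdeal ≤ Z.componentIdeal p) :
    maximalIdeal (ZeroDimScheme.LocalRingAt p) ≤ Z.stalkIdeal p := fun f hf => by
  obtain ⟨e, s, g, -, hg, hsp, hfrac⟩ := exists_smul_val_eq f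
  rw [mem_maximalIdeal_iff_of_smul_val_eq hsp hfrac] at hf
  exact (mem_stalkIdeal_iff_of_smul_val_eq hsp hg hfrac).mpr (hp hf)

lemma HasCoordinates.localLength_le_tangentLength (h : HasCoordinates p a)
    (hv : tangentIdeal a v ≤ Z.componentIdeal p) : Z.localLength p ≤ tangentLength v := by
  classical
  by_cases hI : maximalIdeal (ZeroDimScheme.LocalRingAt p) ≤ Z.stalkIdeal p
  · have hspan (y : ZeroDimScheme.LocalRingAt p) : ∃ z ∈ Submodule.span k
        (({1} : Finset (ZeroDimScheme.LocalRingAt p)) : Set _), y - z ∈ Z.stalkIdeal p := by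
      obtain ⟨c, hc⟩ := h.exists_sub_algebraMap_mem_maximalIdeal y
      rw [Algebra.algebraMap_eq_smul_one] at hc
      exact ⟨c • 1, Submodule.smul_mem _ c (Submodule.subset_span (by simp)), hI hc⟩
    refine (length_quotient_le_card _ hspan).trans ?_
    exact_mod_cast Nat.le_add_right 1 _
  · obtain ⟨x, hx, hxI⟩ := SetLike.not_le_iff_exists.mp hI
    have hv0 : v ≠ 0 := by
      rintro rfl
      exact hI (maximalIdeal_le_stalkIdeal (h.trans_le hv))
    have hspan (y : ZeroDimScheme.LocalRingAt p) : ∃ z ∈ Submodule.span k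
        (({1, x} : Finset (ZeroDimScheme.LocalRingAt p)) : Set _), y - z ∈ Z.stalkIdeal p := by
      obtain ⟨c, hc⟩ := h.exists_sub_algebraMap_mem_maximalIdeal y
      obtain ⟨t, ht⟩ := h.exists_sub_smul_mem_stalkIdeal hv hx hxI hc
      rw [Algebra.algebraMap_eq_smul_one, sub_sub] at ht
      exact ⟨c • 1 + t • x, add_mem (Submodule.smul_mem _ c (Submodule.subset_span (by simp)))
        (Submodule.smul_mem _ t (Submodule.subset_span (by simp))), ht⟩
    refine (length_quotient_le_card _ hspan).trans ?_
    rw [tangentLength_of_ne_zero hv0]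
    exact_mod_cast Finset.card_le_two

end LocalStructure

section HomogeneousIdeal

variable {ι κ τ A : Type*} [Semiring A] [SetLike τ A] [AddSubmonoidClass τ A] [DecidableEq ι]
  [AddMonoid ι] {𝒜 : ι → τ} [GradedRing 𝒜]

lemma mem_finsetInf_homogeneousIdeal {S : Finset κ} {I : κ → HomogeneousIdeal 𝒜} {x : A} :
    x ∈ S.inf I ↔ ∀ i ∈ S, x ∈ I i := by
  simp only [← HomogeneousIdeal.mem_iff, Finset.inf_eq_iInf, HomogeneousIdeal.toIdeal_iInf₂,
    Submodule.mem_iInf]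

end HomogeneousIdeal

section TangentScheme

variable {k : Type*} [Field k] {n : ℕ} {ι : Type*} {S : Finset ι}
  {P : ι → ProjectiveSpectrum (stdGrading k n)} {a v : ι → Fin (n + 1) → k}

lemma exists_eq_of_inf_tangentIdeal_le (h : ∀ i, HasCoordinates (P i) (a i))
    {q : ProjectiveSpectrum (stdGrading k n)}
    (hq : (S.inf fun i => tangentIdeal (a i) (v i)) ≤ q.asHomogeneousIdeal) : ∃ i ∈ S, P i = q := by
  have hq' : (S.inf fun i => (tangentIdeal (a i) (v i)).toIdeal) ≤ q.asHomogeneousIdeal.toIdeal :=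
    fun f hf => hq (mem_finsetInf_homogeneousIdeal.mpr (Submodule.mem_finsetInf.mp hf))
  obtain ⟨i, hi, hiq⟩ := q.isPrime.inf_le'.mp hq'
  refine ⟨i, hi, ((h i).eq_of_le fun _ hf => ?_).symm⟩
  rw [h i] at hf
  exact or_self_iff.mp (q.isPrime.mem_or_mem
    (hiq (tangentIdeal_zero_mul_self_le _ _ (Ideal.mul_mem_mul hf hf))))

/-- The union, over `i ∈ S`, of the schemes cut out by `tangentIdeal (a i) (v i)`, where `a i` are
homogeneous coordinates of the point `P i`. -/
def tangentScheme (S : Finset ι) (v : ι → Fin (n + 1) → k)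
    (h : ∀ i, HasCoordinates (P i) (a i)) : ZeroDimScheme k n where
  ideal := S.inf fun i => tangentIdeal (a i) (v i)
  saturated _ hf := mem_finsetInf_homogeneousIdeal.mpr fun i hi =>
    mem_tangentIdeal_of_forall_X_mul_mem (h i).ne_zero fun j =>
      mem_finsetInf_homogeneousIdeal.mp (hf j) i hi
  finite_zeroLocus := (S.finite_toSet.image P).subset fun _ hq =>
    exists_eq_of_inf_tangentIdeal_le h hq

lemma exists_mem_asHomogeneousIdeal_forall_ne (h : ∀ i, HasCoordinates (P i) (a i))
    (hP : Function.Injective P) (i : ι) :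
    ∃ g ∉ (P i).asHomogeneousIdeal, ∀ j ∈ S, j ≠ i → g ∈ (P j).asHomogeneousIdeal := by
  classical
  by_contra! hg
  have hle : ((S.erase i).inf fun j => (P j).asHomogeneousIdeal.toIdeal) ≤
      (P i).asHomogeneousIdeal.toIdeal := fun g hgS => by
    by_contra hgi
    obtain ⟨j, hj, hji, hgj⟩ := hg g hgi
    exact hgj (Submodule.mem_finsetInf.mp hgS j (Finset.mem_erase.mpr ⟨hji, hj⟩))
  obtain ⟨j, hj, hji⟩ := (P i).isPrime.inf_le'.mp hle
  exact Finset.ne_of_mem_erase hj (hP ((h j).eq_of_le hji)).symm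

variable (h : ∀ i, HasCoordinates (P i) (a i))

lemma tangentIdeal_le_componentIdeal_tangentScheme (hP : Function.Injective P) (i : ι) :
    tangentIdeal (a i) (v i) ≤ (tangentScheme S v h).componentIdeal (P i) := by
  obtain ⟨g, hgi, hg⟩ := exists_mem_asHomogeneousIdeal_forall_ne (S := S) h hP i
  refine homogeneousIdeal_le_of_forall_homogeneous_mem fun e f hf hfi =>
    (ZeroDimScheme.mem_componentIdeal_iff hf).mpr ⟨g * g, ?_, ?_⟩
  · exact fun hgg => hgi (or_self_iff.mp ((P i).isPrime.mem_or_mem hgg))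
  refine mem_finsetInf_homogeneousIdeal.mpr fun j hj => ?_
  rcases eq_or_ne j i with rfl | hji
  · exact Ideal.mul_mem_left _ _ hfi
  · have hgj : g ∈ tangentIdeal (a j) 0 := h j ▸ hg j hj hji
    exact Ideal.mul_mem_right _ _ (tangentIdeal_zero_mul_self_le _ _ (Ideal.mul_mem_mul hgj hgj))

lemma len_tangentScheme_le (hP : Function.Injective P) :
    (tangentScheme S v h).len ≤ ∑ i ∈ S, (tangentLength (v i) : ℕ∞) := by
  have hsub : (tangentScheme S v h).points ⊆ S.map ⟨P, hP⟩ := fun q hq =>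
    Finset.mem_map.mpr (exists_eq_of_inf_tangentIdeal_le h (ZeroDimScheme.mem_points.mp hq))
  calc (tangentScheme S v h).len
      ≤ ∑ q ∈ S.map ⟨P, hP⟩, (tangentScheme S v h).localLength q :=
        Finset.sum_le_sum_of_subset hsub
    _ = ∑ i ∈ S, (tangentScheme S v h).localLength (P i) := Finset.sum_map _ _ _
    _ ≤ ∑ i ∈ S, (tangentLength (v i) : ℕ∞) := Finset.sum_le_sum fun i _ =>
        (h i).localLength_le_tangentLength (tangentIdeal_le_componentIdeal_tangentScheme h hP i)

end TangentScheme

section Pairing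

variable {k : Type*} [Field k] {n d : ℕ} {F : MvPolynomial (Fin (n + 1)) k}

/-- The apolar pairing of `R` with `S`: the constant term of `G ∘ F`, as a linear functional
of `G`. -/
def apolarPairing (F : MvPolynomial (Fin (n + 1)) k) : MvPolynomial (Fin (n + 1)) k →ₗ[k] k :=
  ∑ α ∈ F.support, (((∏ i, (α i).factorial : ℕ) : k) * coeff α F) • lcoeff k α

lemma apolarPairing_apply (F G : MvPolynomial (Fin (n + 1)) k) :
    apolarPairing F G =
      ∑ α ∈ F.support, ((∏ i, (α i).factorial : ℕ) : k) * coeff α F * coeff α G := by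
  simp [apolarPairing]

lemma apolarPairing_monomial (F : MvPolynomial (Fin (n + 1)) k) (δ : Fin (n + 1) →₀ ℕ) (c : k) :
    apolarPairing F (monomial δ c) = ((∏ i, (δ i).factorial : ℕ) : k) * coeff δ F * c := by
  classical
  rw [apolarPairing_apply, Finset.sum_eq_single δ]
  · simp
  · intro α _ hα
    rw [coeff_monomial, if_neg hα.symm, mul_zero]
  · intro hδ
    simp [notMem_support_iff.mp hδ]

lemma prod_descFactorial_eq_zero {σ : Type*} [Fintype σ] {α β : σ →₀ ℕ} (h : ¬ β ≤ α) :
    ∏ i, (α i).descFactorial (β i) = 0 := by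
  obtain ⟨i, hi⟩ := not_forall.mp h
  exact Finset.prod_eq_zero (Finset.mem_univ i) (Nat.descFactorial_of_lt (not_le.mp hi))

lemma prod_factorial_mul_prod_descFactorial {σ : Type*} [Fintype σ] (γ β : σ →₀ ℕ) :
    (∏ i, (γ i).factorial) * ∏ i, ((γ + β) i).descFactorial (β i) =
      ∏ i, ((γ + β) i).factorial := by
  rw [← Finset.prod_mul_distrib]
  refine Finset.prod_congr rfl fun i _ => ?_
  simpa using Nat.factorial_mul_descFactorial (Nat.le_add_left (β i) (γ i))

lemma coeff_monomialDeriv (β γ : Fin (n + 1) →₀ ℕ) (F : MvPolynomial (Fin (n + 1)) k) :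
    coeff γ (monomialDeriv β F) =
      ((∏ i, ((γ + β) i).descFactorial (β i) : ℕ) : k) * coeff (γ + β) F := by
  classical
  rw [monomialDeriv, coeff_sum, Finset.sum_eq_single (γ + β)]
  · rw [add_tsub_cancel_right, coeff_monomial, if_pos rfl]
  · intro α _ hα
    rw [coeff_monomial]
    split_ifs with hγ
    · have hβ : ¬ β ≤ α := fun hβ => hα (by rw [← hγ, tsub_add_cancel_of_le hβ])
      rw [prod_descFactorial_eq_zero hβ, Nat.cast_zero, zero_mul]
    · rfl
  · intro hα
    simp [notMem_support_iff.mp hα]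

lemma prod_factorial_mul_coeff_diffAction (γ : Fin (n + 1) →₀ ℕ)
    (G F : MvPolynomial (Fin (n + 1)) k) :
    ((∏ i, (γ i).factorial : ℕ) : k) * coeff γ (diffAction G F) =
      apolarPairing F (monomial γ 1 * G) := by
  conv_rhs => rw [G.as_sum, Finset.mul_sum, map_sum]
  rw [diffAction, coeff_sum, Finset.mul_sum]
  refine Finset.sum_congr rfl fun β _ => ?_
  rw [monomial_mul, one_mul, apolarPairing_monomial, ← prod_factorial_mul_prod_descFactorial,
    coeff_smul, smul_eq_mul, coeff_monomialDeriv, Nat.cast_mul]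
  ring

lemma coeff_diffAction_eq_zero (hF : F.IsHomogeneous d) {γ : Fin (n + 1) →₀ ℕ}
    (hγ : d < γ.degree) (G : MvPolynomial (Fin (n + 1)) k) : coeff γ (diffAction G F) = 0 := by
  rw [diffAction, coeff_sum]
  refine Finset.sum_eq_zero fun β _ => ?_
  rw [coeff_smul, coeff_monomialDeriv, hF.coeff_eq_zero, mul_zero, smul_zero]
  rw [map_add]
  omega

lemma cast_prod_factorial_ne_zero (hd : (d.factorial : k) ≠ 0) {γ : Fin (n + 1) →₀ ℕ}
    (hγ : γ.degree ≤ d) : ((∏ i, (γ i).factorial : ℕ) : k) ≠ 0 := by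
  have hdvd : ∏ i, (γ i).factorial ∣ d.factorial :=
    (Nat.prod_factorial_dvd_factorial_sum _ _).trans
      (Nat.factorial_dvd_factorial ((Finsupp.degree_eq_sum γ).symm.trans_le hγ))
  exact fun h => hd (zero_dvd_iff.mp (h ▸ Nat.cast_dvd_cast hdvd))

lemma mem_ann_iff (hd : (d.factorial : k) ≠ 0) (hF : F.IsHomogeneous d)
    {G : MvPolynomial (Fin (n + 1)) k} :
    G ∈ Ann F ↔ ∀ γ, apolarPairing F (monomial γ 1 * G) = 0 := by
  change diffAction G F = 0 ↔ _
  simp only [MvPolynomial.ext_iff, ← prod_factorial_mul_coeff_diffAction, coeff_zero, mul_eq_zero]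
  refine forall_congr' fun γ => ⟨Or.inr, fun h => ?_⟩
  rcases le_or_gt γ.degree d with hγ | hγ
  · exact h.resolve_left (cast_prod_factorial_ne_zero hd hγ)
  · exact coeff_diffAction_eq_zero hF hγ G

lemma apolarPairing_homogeneousComponent (hF : F.IsHomogeneous d)
    (G : MvPolynomial (Fin (n + 1)) k) :
    apolarPairing F (homogeneousComponent d G) = apolarPairing F G := by
  rw [apolarPairing_apply, apolarPairing_apply]
  refine Finset.sum_congr rfl fun α hα => ?_
  rw [coeff_homogeneousComponent, if_pos]
  rw [hF.degree_eq_sum_deg_support hα]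
  rfl

lemma ZeroDimScheme.isApolar_iff (hd : (d.factorial : k) ≠ 0) (hF : F.IsHomogeneous d)
    {Z : ZeroDimScheme k n} :
    Z.IsApolar F ↔ ∀ G : MvPolynomial (Fin (n + 1)) k, G.IsHomogeneous d →
      G ∈ Z.ideal → apolarPairing F G = 0 := by
  constructor
  · intro h G _ hGI
    simpa using (mem_ann_iff hd hF).mp (h hGI) 0
  · intro h G hG
    refine (mem_ann_iff hd hF).mpr fun γ => ?_
    rw [← apolarPairing_homogeneousComponent hF]
    refine h _ (homogeneousComponent_isHomogeneous d _) ?_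
    rw [← decomposition.decompose'_apply]
    exact Z.ideal.isHomogeneous d (Ideal.mul_mem_left _ _ hG)

end Pairing

lemma finrank_quotient_dualCoannihilator_map {k E M : Type*} [Field k] [AddCommGroup E]
    [Module k E] [AddCommGroup M] [Module k M] {f : E →ₗ[k] Module.Dual k M} {p : Submodule k E}
    [FiniteDimensional k p] (h : Disjoint p (LinearMap.ker f)) :
    Module.finrank k (M ⧸ (p.map f).dualCoannihilator) = Module.finrank k p := by
  rw [← Subspace.dual_finrank_eq, ← (LinearEquiv.ofBijective _
    (Subspace.flip_quotDualCoannihilatorToDual_bijective (p.map f))).finrank_eq,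
    ← LinearMap.range_domRestrict,
    LinearMap.finrank_range_of_inj (LinearMap.injective_domRestrict_iff.mpr h)]

section Jets

variable {k σ : Type*} [Field k] {d : ℕ}

lemma tangentLength_le_of_imp {v w : σ → k} (h : v = 0 → w = 0) :
    tangentLength w ≤ tangentLength v := by
  rcases eq_or_ne v 0 with hv | hv
  · rw [h hv, hv]
  · exact (tangentLength_le_two w).trans_eq (tangentLength_of_ne_zero hv).symm

lemma exists_isHomogeneous_eval_eq_mul_dirDeriv [Fintype σ] {G l : MvPolynomial σ k}
    (hG : G.IsHomogeneous d) (hl : l.IsHomogeneous 1) (w : σ → k) :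
    ∃ H : MvPolynomial σ k, H.IsHomogeneous d ∧
      ∀ x, eval x H = eval x l * dirDeriv x w G := by
  rcases d with _ | d
  · refine ⟨0, isHomogeneous_zero _ _ _, fun x => ?_⟩
    rw [totalDegree_eq_zero_iff_eq_C.mp ((totalDegree_zero_iff_isHomogeneous (p := G)).mpr hG)]
    simp [dirDeriv_apply]
  · refine ⟨(∑ i, C (w i) * pderiv i G) * l, ?_, fun x => ?_⟩
    · exact (IsHomogeneous.sum _ _ _ fun i _ => (hG.pderiv (i := i)).C_mul (w i)).mul hl
    · simp [dirDeriv_apply, mul_comm]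

variable {ι : Type*} {a v : ι → σ → k}

/-- The families of scalars and tangent vectors whose `i`-th tangent vector is a multiple
of `v i`. -/
def jetSpace (v : ι → σ → k) : Submodule k (ι → k × (σ → k)) :=
  Submodule.pi Set.univ fun i => (⊤ : Submodule k k).prod (Submodule.span k {v i})

lemma mem_jetSpace {x : ι → k × (σ → k)} :
    x ∈ jetSpace v ↔ ∀ i, (x i).2 ∈ Submodule.span k {v i} := by
  simp [jetSpace, Submodule.mem_pi]

lemma snd_eq_zero_of_mem_jetSpace {x : ι → k × (σ → k)} (hx : x ∈ jetSpace v) {i : ι}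
    (hi : v i = 0) : (x i).2 = 0 := by
  simpa [hi] using mem_jetSpace.mp hx i

variable [Fintype ι]

lemma finrank_jetSpace (v : ι → σ → k) :
    Module.finrank k (jetSpace v) = ∑ i, tangentLength (v i) := by
  set f := LinearMap.piMap fun i =>
    LinearMap.id.prodMap (M := k) (Submodule.span k {v i}).subtype
  have hinj : Function.Injective f :=
    Function.Injective.piMap fun i =>
      Function.Injective.prodMap Function.injective_id (Submodule.injective_subtype _)
  have hrange : jetSpace v = LinearMap.range f := by
    ext x
    refine mem_jetSpace.trans ⟨fun hx => ⟨fun i => ((x i).1, ⟨(x i).2, hx i⟩), rfl⟩, ?_⟩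
    rintro ⟨y, rfl⟩ i
    exact (y i).2.2
  rw [hrange, LinearMap.finrank_range_of_inj hinj, Module.finrank_pi_fintype]
  simp only [Module.finrank_prod, Module.finrank_self, tangentLength]

variable [Fintype σ]

/-- The functional `G ↦ ∑ i, (c i * G(a i) + (∂G/∂(u i))(a i))` on the forms `G` of degree `d`
given by a family `x i = (c i, u i)` of scalars and tangent vectors at the points `a i`. -/
def jetFunctional (a : ι → σ → k) (d : ℕ) :
    (ι → k × (σ → k)) →ₗ[k] Module.Dual k (homogeneousSubmodule σ k d) :=
  (homogeneousSubmodule σ k d).subtype.dualMap ∘ₗ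
    ∑ i, (LinearMap.toSpanSingleton k _ (aeval (a i)).toLinearMap).coprod (dirDeriv (a i)) ∘ₗ
      LinearMap.proj i

lemma jetFunctional_apply (x : ι → k × (σ → k)) (G : homogeneousSubmodule σ k d) :
    jetFunctional a d x G =
      ∑ i, ((x i).1 * eval (a i) G.1 + dirDeriv (a i) (x i).2 G.1) := by
  simp [jetFunctional, aeval_eq_eval]

lemma jetFunctional_single [DecidableEq ι] (i : ι) (x : k × (σ → k))
    (G : homogeneousSubmodule σ k d) :
    jetFunctional a d (Pi.single i x) G = x.1 * eval (a i) G.1 + dirDeriv (a i) x.2 G.1 := by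
  rw [jetFunctional_apply, Finset.sum_eq_single_of_mem i (Finset.mem_univ i)]
  · rw [Pi.single_eq_same]
  · intro j _ hj
    simp [Pi.single_eq_of_ne hj]

lemma jetFunctional_tangent_eq_zero {c : ι → k} {l : MvPolynomial σ k} (hl : l.IsHomogeneous 1)
    (w : σ → k) (hc : jetFunctional a d (fun i => (c i, 0)) = 0) :
    jetFunctional a d (fun i => (0, (c i * eval (a i) l) • w)) = 0 := by
  ext G
  obtain ⟨H, hH, hHx⟩ := exists_isHomogeneous_eval_eq_mul_dirDeriv G.2 hl w
  refine Eq.trans ?_ (LinearMap.congr_fun hc ⟨H, hH⟩)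
  simp [jetFunctional_apply, hHx, mul_assoc]

/-- The subschemes of length at most two spanned by the tangent vectors `v i` at the points `a i`
impose independent conditions on the forms of degree `d`. -/
def ImposeIndependentConditions (a v : ι → σ → k) (d : ℕ) : Prop :=
  Disjoint (jetSpace v) (LinearMap.ker (jetFunctional a d))

lemma imposeIndependentConditions_iff :
    ImposeIndependentConditions a v d ↔
      ∀ x ∈ jetSpace v, jetFunctional a d x = 0 → x = 0 :=
  LinearMap.disjoint_ker

lemma ImposeIndependentConditions.succ (h : ImposeIndependentConditions a v d)
    (ha : ∀ i, a i ≠ 0) : ImposeIndependentConditions a v (d + 1) := by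
  refine imposeIndependentConditions_iff.mpr fun x hx hrel => funext fun i => ?_
  obtain ⟨l, hl, hla⟩ := exists_isHomogeneous_one_eval_eq_one (ha i)
  set y : ι → k × (σ → k) := fun j =>
    ((x j).1 * eval (a j) l + dirDeriv (a j) (x j).2 l, eval (a j) l • (x j).2) with hy
  have hyrel : jetFunctional a d y = 0 := by
    ext G
    refine Eq.trans ?_ (LinearMap.congr_fun hrel ⟨G * l, G.2.mul hl⟩)
    simp only [jetFunctional_apply, hy, map_mul, map_smul, dirDeriv_mul, LinearMap.smul_apply,
      smul_eq_mul]
    exact Finset.sum_congr rfl fun j _ => by ring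
  have hymem : y ∈ jetSpace v :=
    mem_jetSpace.mpr fun j => Submodule.smul_mem _ _ (mem_jetSpace.mp hx j)
  have hyi := congrFun (imposeIndependentConditions_iff.mp h y hymem hyrel) i
  obtain ⟨h₁, h₂⟩ := Prod.ext_iff.mp hyi
  have hx₂ : (x i).2 = 0 := by simpa [hy, hla] using h₂
  exact Prod.ext (by simpa [hy, hla, hx₂] using h₁) hx₂

lemma mem_dualCoannihilator_map_jetFunctional_iff {G : homogeneousSubmodule σ k d} :
    G ∈ ((jetSpace v).map (jetFunctional a d)).dualCoannihilator ↔
      ∀ i, eval (a i) G.1 = 0 ∧ dirDeriv (a i) (v i) G.1 = 0 := by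
  classical
  rw [Submodule.mem_dualCoannihilator]
  refine ⟨fun h i => ⟨?_, ?_⟩, ?_⟩
  · have hmem : Pi.single i (1, 0) ∈ jetSpace v := mem_jetSpace.mpr fun j => by
      rcases eq_or_ne j i with rfl | hj <;> simp [*]
    simpa [jetFunctional_single] using h _ ⟨_, hmem, rfl⟩
  · have hmem : Pi.single i (0, v i) ∈ jetSpace v := mem_jetSpace.mpr fun j => by
      rcases eq_or_ne j i with rfl | hj <;> simp [*, Submodule.mem_span_singleton_self]
    simpa [jetFunctional_single] using h _ ⟨_, hmem, rfl⟩
  · rintro h _ ⟨x, hx, rfl⟩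
    rw [jetFunctional_apply]
    refine Finset.sum_eq_zero fun i _ => ?_
    obtain ⟨c, hc⟩ := Submodule.mem_span_singleton.mp (mem_jetSpace.mp hx i)
    simp [← hc, (h i).1, (h i).2]

lemma exists_mem_jetSpace_jetFunctional_eq {ψ : Module.Dual k (homogeneousSubmodule σ k d)}
    (hψ : ∀ G : homogeneousSubmodule σ k d,
      (∀ i, eval (a i) G.1 = 0 ∧ dirDeriv (a i) (v i) G.1 = 0) → ψ G = 0) :
    ∃ x ∈ jetSpace v, jetFunctional a d x = ψ := by
  rw [← Submodule.mem_map, ← Subspace.dualCoannihilator_dualAnnihilator_eq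
    (W := (jetSpace v).map (jetFunctional a d)), Submodule.mem_dualAnnihilator]
  exact fun G hG => hψ G (mem_dualCoannihilator_map_jetFunctional_iff.mp hG)

/-- A sum of point evaluations and derivatives representing the functional `ψ` on forms of degree
`d` uses at least the total length of the tangent vectors `v i`; the summands that do not occur in
it, those outside `S`, are not counted. -/
def IsShortest (a v : ι → σ → k) (ψ : Module.Dual k (homogeneousSubmodule σ k d)) : Prop :=
  ∀ (S : Finset ι) (y : ι → k × (σ → k)), (∀ i ∉ S, y i = 0) → jetFunctional a d y = ψ →
    ∑ i, tangentLength (v i) ≤ ∑ i ∈ S, tangentLength (y i).2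

namespace IsShortest

variable {ψ : Module.Dual k (homogeneousSubmodule σ k d)} {x y γ : ι → k × (σ → k)} {p : ι}

lemma ne_zero (h : IsShortest a v ψ) (hy : jetFunctional a d y = ψ)
    (hyv : ∀ i, v i = 0 → (y i).2 = 0) (p : ι) : y p ≠ 0 := fun hp => by
  classical
  refine (h (Finset.univ.erase p) y (fun i hi => by simp_all) hy).not_gt ?_
  rw [← Finset.add_sum_erase _ _ (Finset.mem_univ p), add_comm]
  exact Nat.lt_add_right_iff_pos.mpr (by simp [tangentLength]) |>.trans_le' <|
    Finset.sum_le_sum fun i _ => tangentLength_le_of_imp (hyv i)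

lemma snd_ne_zero (h : IsShortest a v ψ) (hy : jetFunctional a d y = ψ)
    (hyv : ∀ i, v i = 0 → (y i).2 = 0) (hp : v p ≠ 0) : (y p).2 ≠ 0 := fun hyp => by
  refine (h Finset.univ y (fun i hi => absurd (Finset.mem_univ i) hi) hy).not_gt
    (Finset.sum_lt_sum (fun i _ => tangentLength_le_of_imp (hyv i)) ⟨p, Finset.mem_univ p, ?_⟩)
  rw [hyp, tangentLength_zero, tangentLength_of_ne_zero hp]
  exact one_lt_two

lemma snd_eq_zero_of_relation (h : IsShortest a v ψ) (hx : x ∈ jetSpace v)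
    (hxψ : jetFunctional a d x = ψ) (hγ : γ ∈ jetSpace v) (hγ₀ : jetFunctional a d γ = 0) (p : ι) :
    (γ p).2 = 0 := by
  obtain ⟨r, hr⟩ := Submodule.mem_span_singleton.mp (mem_jetSpace.mp hγ p)
  obtain ⟨s, hs⟩ := Submodule.mem_span_singleton.mp (mem_jetSpace.mp hx p)
  by_contra hne
  obtain ⟨hr₀, hv⟩ := smul_ne_zero_iff.mp (hr.trans_ne hne)
  have hy : x - (s / r) • γ ∈ jetSpace v :=
    Submodule.sub_mem _ hx (Submodule.smul_mem _ _ hγ)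
  refine h.snd_ne_zero (by rw [map_sub, map_smul, hγ₀, smul_zero, sub_zero, hxψ])
    (fun i hi => snd_eq_zero_of_mem_jetSpace hy hi) hv ?_
  simp [← hr, ← hs, smul_smul, hr₀]

lemma fst_eq_zero_of_relation_of_eq_zero (h : IsShortest a v ψ) (hx : x ∈ jetSpace v)
    (hxψ : jetFunctional a d x = ψ) (hγ : γ ∈ jetSpace v) (hγ₀ : jetFunctional a d γ = 0)
    (hp : v p = 0) : (γ p).1 = 0 := by
  by_contra hne
  have hy : x - ((x p).1 / (γ p).1) • γ ∈ jetSpace v :=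
    Submodule.sub_mem _ hx (Submodule.smul_mem _ _ hγ)
  have hyv := fun i (hi : v i = 0) => snd_eq_zero_of_mem_jetSpace hy hi
  refine h.ne_zero (by rw [map_sub, map_smul, hγ₀, smul_zero, sub_zero, hxψ]) hyv p
    (Prod.ext ?_ (hyv p hp))
  simp [hne]

lemma fst_eq_zero_of_relation_of_ne_zero (h : IsShortest a v ψ) (ha : a p ≠ 0)
    (hx : x ∈ jetSpace v) (hxψ : jetFunctional a d x = ψ) (hγ : γ ∈ jetSpace v)
    (hγ₀ : jetFunctional a d γ = 0) (hp : v p ≠ 0) : (γ p).1 = 0 := by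
  obtain ⟨s, hs⟩ := Submodule.mem_span_singleton.mp (mem_jetSpace.mp hx p)
  obtain ⟨l, hl, hla⟩ := exists_isHomogeneous_one_eval_eq_one ha
  have hγ₁ : γ = fun i => ((γ i).1, 0) :=
    funext fun i => Prod.ext rfl (h.snd_eq_zero_of_relation hx hxψ hγ hγ₀ i)
  set z : ι → k × (σ → k) := fun i => (0, ((γ i).1 * eval (a i) l) • v p) with hz
  have hz₀ : jetFunctional a d z = 0 := jetFunctional_tangent_eq_zero hl (v p) (hγ₁ ▸ hγ₀)
  by_contra hne
  refine h.snd_ne_zero (y := x - (s / (γ p).1) • z)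
    (by rw [map_sub, map_smul, hz₀, smul_zero, sub_zero, hxψ]) (fun i hi => ?_) hp ?_
  · simp [hz, snd_eq_zero_of_mem_jetSpace hx hi,
      h.fst_eq_zero_of_relation_of_eq_zero hx hxψ hγ hγ₀ hi]
  · simp [hz, ← hs, hla, smul_smul, hne]

lemma imposeIndependentConditions (h : IsShortest a v ψ) (ha : ∀ i, a i ≠ 0)
    (hx : x ∈ jetSpace v) (hxψ : jetFunctional a d x = ψ) :
    ImposeIndependentConditions a v d := by
  refine imposeIndependentConditions_iff.mpr fun γ hγ hγ₀ => funext fun p => Prod.ext ?_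
    (h.snd_eq_zero_of_relation hx hxψ hγ hγ₀ p)
  by_cases hp : v p = 0
  · exact h.fst_eq_zero_of_relation_of_eq_zero hx hxψ hγ hγ₀ hp
  · exact h.fst_eq_zero_of_relation_of_ne_zero (ha p) hx hxψ hγ hγ₀ hp

end IsShortest

end Jets

lemma ZeroDimScheme.HF_eq_sum_tangentLength {k ι : Type*} [Field k] [Fintype ι] {n d : ℕ}
    {a v : ι → Fin (n + 1) → k} {Z : ZeroDimScheme k n}
    (hZ : Z.ideal = Finset.univ.inf fun i => tangentIdeal (a i) (v i))
    (h : ImposeIndependentConditions a v d) : Z.HF d = ∑ i, tangentLength (v i) := by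
  have hI : (Z.ideal.toIdeal.restrictScalars k).comap (stdGrading k n d).subtype =
      ((jetSpace v).map (jetFunctional a d)).dualCoannihilator := by
    ext G
    rw [mem_dualCoannihilator_map_jetFunctional_iff]
    change G.1 ∈ Z.ideal ↔ _
    simp only [hZ, mem_finsetInf_homogeneousIdeal, Finset.mem_univ, true_imp_iff,
      mem_tangentIdeal_iff G.2]
  rw [HF, hI, finrank_quotient_dualCoannihilator_map h, finrank_jetSpace]

section MinimalApolar

variable {k : Type*} [Field k] {n d : ℕ} {F : MvPolynomial (Fin (n + 1)) k} {Z : ZeroDimScheme k n}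

lemma ZeroDimScheme.exists_eq_inf_tangentIdeal [IsAlgClosed k]
    (hlen : ∀ p ∈ Z.points, Z.localLength p ≤ 2) :
    ∃ a v : Z.points → Fin (n + 1) → k, (∀ p, HasCoordinates p.1 (a p)) ∧
      (Z.ideal = Finset.univ.inf fun p => tangentIdeal (a p) (v p)) ∧
      Z.len = (∑ p, tangentLength (v p) : ℕ) := by
  choose a ha using fun p : Z.points => Z.exists_hasCoordinates_of_mem_points p.2
  choose v hv hvlen using fun p : Z.points =>
    (ha p).exists_componentIdeal_eq_tangentIdeal p.2 (hlen p p.2)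
  refine ⟨a, v, ha, ?_, ?_⟩
  · rw [ideal_eq_inf_componentIdeal, ← Finset.inf_attach, Finset.univ_eq_attach]
    exact Finset.inf_congr rfl fun p _ => hv p
  · rw [len, ← Finset.sum_coe_sort, Nat.cast_sum]
    exact Finset.sum_congr rfl fun p _ =>
      ((ha p).localLength_le_tangentLength (hv p).ge).antisymm (hvlen p)

variable {ι : Type*} [Fintype ι] {P : ι → ProjectiveSpectrum (stdGrading k n)}
  {a v : ι → Fin (n + 1) → k}

lemma isApolar_tangentScheme (hd : (d.factorial : k) ≠ 0) (hF : F.IsHomogeneous d)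
    (h : ∀ i, HasCoordinates (P i) (a i)) {S : Finset ι} {y : ι → k × (Fin (n + 1) → k)}
    (hyS : ∀ i ∉ S, y i = 0)
    (hy : jetFunctional a d y = (apolarPairing F).domRestrict (stdGrading k n d)) :
    (tangentScheme S (fun i => (y i).2) h).IsApolar F := by
  refine (ZeroDimScheme.isApolar_iff hd hF).mpr fun G hG hGI => ?_
  refine (LinearMap.congr_fun hy ⟨G, hG⟩).symm.trans ?_
  rw [jetFunctional_apply]
  refine Finset.sum_eq_zero fun i _ => ?_
  by_cases hi : i ∈ S
  · obtain ⟨hval, hder⟩ := (mem_tangentIdeal_iff hG).mp (mem_finsetInf_homogeneousIdeal.mp hGI i hi)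
    rw [hval, hder, mul_zero, add_zero]
  · simp [hyS i hi]

lemma isShortest_of_isMinimalApolar (hd : (d.factorial : k) ≠ 0) (hF : F.IsHomogeneous d)
    (h : ∀ i, HasCoordinates (P i) (a i)) (hP : Function.Injective P)
    (hlen : Z.len = (∑ i, tangentLength (v i) : ℕ)) (hmin : Z.IsMinimalApolar F) :
    IsShortest a v ((apolarPairing F).domRestrict (stdGrading k n d)) := fun S y hyS hy => by
  have hle := (hmin.2 _ (isApolar_tangentScheme hd hF h hyS hy)).trans (len_tangentScheme_le h hP)
  rw [hlen] at hle
  exact_mod_cast hle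

lemma exists_jetFunctional_eq_apolarPairing (hd : (d.factorial : k) ≠ 0) (hF : F.IsHomogeneous d)
    (hZ : Z.ideal = Finset.univ.inf fun i => tangentIdeal (a i) (v i)) (hap : Z.IsApolar F) :
    ∃ x ∈ jetSpace v,
      jetFunctional a d x = (apolarPairing F).domRestrict (stdGrading k n d) := by
  refine exists_mem_jetSpace_jetFunctional_eq fun G hG => ?_
  refine (ZeroDimScheme.isApolar_iff hd hF).mp hap G.1 G.2 ?_
  rw [hZ, mem_finsetInf_homogeneousIdeal]
  exact fun i _ => (mem_tangentIdeal_iff G.2).mpr (hG i)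

end MinimalApolar

end

end Apolarity

open Apolarity in
theorem mainTheorem1_general {k : Type*} [Field k] [IsAlgClosed k] {n d : ℕ}
    (hd : (d.factorial : k) ≠ 0) (F : MvPolynomial (Fin (n + 1)) k) (hF : F.IsHomogeneous d)
    (Z : ZeroDimScheme k n) (hlen : ∀ p ∈ Z.points, Z.localLength p ≤ 2)
    (hmin : Z.IsMinimalApolar F) : Z.IsRegularInDegree d := by
  obtain ⟨a, v, ha, hZ, hZlen⟩ := Z.exists_eq_inf_tangentIdeal hlen
  have ha₀ : ∀ p, a p ≠ 0 := fun p => (ha p).ne_zero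
  obtain ⟨x, hx, hxF⟩ := exists_jetFunctional_eq_apolarPairing hd hF hZ hmin.1
  have hind : ImposeIndependentConditions a v d :=
    (isShortest_of_isMinimalApolar hd hF ha Subtype.val_injective hZlen
      hmin).imposeIndependentConditions ha₀ hx hxF
  refine iInf₂_le d ⟨?_, ?_⟩
  · rw [ZeroDimScheme.HF_eq_sum_tangentLength hZ hind, hZlen]
  · rw [ZeroDimScheme.HF_eq_sum_tangentLength hZ (hind.succ ha₀), hZlen]

theorem mainTheorem1 {k : Type*} [Field k] [IsAlgClosed k] [CharZero k] {n d : ℕ}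
    (F : MvPolynomial (Fin (n + 1)) k) (hF : F.IsHomogeneous d)
    (Z : Apolarity.ZeroDimScheme k n)
    (hlen : ∀ p ∈ Z.points, Z.localLength p ≤ 2)
    (hmin : Z.IsMinimalApolar F) :
    Z.IsRegularInDegree d :=
  mainTheorem1_general (Nat.cast_ne_zero.mpr d.factorial_ne_zero) F hF Z hlen hmin
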